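/- Let $F$ be a field of characteristic zero and let $L$ be a finite-dimensional (right) Leibniz algebra over $F$, i.e. a finite-dimensional $F$-vector space with a bilinear product $[\cdot,\cdot]$ satisfying $[x,[y,z]]=[[x,y],z]-[[x,z],y]$ for all $x,y,z\in L$. Suppose that for every $x\in L$ the centralizer $C_L(x)=\{y\in L : [x,y]=[y,x]=0\}$ is a (two-sided) ideal of $L$. Then $L$ is solvable: with $L^{(0)}=L$ and $L^{(k+1)}=\operatorname{span}\{[x,y] : x,y\in L^{(k)}\}$, one has $L^{(n)}=0$ for some $n\ge 1$. -/

import Mathlib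

/-! Nonassociative algebras over a field `F` are modelled by
`[NonUnitalNonAssocRing A] [Module F A] [IsScalarTower F A A] [SMulCommClass F A A]`
(a vector space with a bilinear product); the Leibniz bracket `[x, y]` is written `x * y`. -/

namespace NonassocAlg

/-- The (right) Leibniz identity `[x, [y, z]] = [[x, y], z] - [[x, z], y]`. -/
def IsLeibniz (A : Type*) [NonUnitalNonAssocRing A] : Prop :=
  ∀ x y z : A, x * (y * z) = (x * y) * z - (x * z) * y

/-- A subspace that is a two-sided ideal. -/
def IsIdeal {F A : Type*} [Field F] [NonUnitalNonAssocRing A] [Module F A]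
    (I : Submodule F A) : Prop :=
  ∀ y ∈ I, ∀ z : A, y * z ∈ I ∧ z * y ∈ I

/-- The centralizer `C_A(x) = {y ∈ A | xy = yx = 0}`, as a subspace of `A`. -/
def centralizer (F : Type*) {A : Type*} [Field F] [NonUnitalNonAssocRing A] [Module F A]
    [IsScalarTower F A A] [SMulCommClass F A A] (x : A) : Submodule F A where
  carrier := {y | x * y = 0 ∧ y * x = 0}
  zero_mem' := by simp
  add_mem' := by
    rintro a b ⟨ha, ha'⟩ ⟨hb, hb'⟩
    exact ⟨by rw [mul_add, ha, hb, add_zero], by rw [add_mul, ha', hb', add_zero]⟩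
  smul_mem' := by
    rintro c a ⟨ha, ha'⟩
    exact ⟨by rw [mul_smul_comm, ha, smul_zero], by rw [smul_mul_assoc, ha', smul_zero]⟩

/-- A CL-algebra: the centralizer of every element is an ideal. -/
def IsCL (F A : Type*) [Field F] [NonUnitalNonAssocRing A] [Module F A]
    [IsScalarTower F A A] [SMulCommClass F A A] : Prop :=
  ∀ x : A, IsIdeal (centralizer F x)

/-- The derived series: `A^(0) = A`, and `A^(k+1)` is the linear span of all products of two
elements of `A^(k)`. -/
def derivedSeries (F A : Type*) [Field F] [NonUnitalNonAssocRing A] [Module F A] :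
    ℕ → Submodule F A
  | 0 => ⊤
  | k + 1 => Submodule.span F
      {w | ∃ x ∈ derivedSeries F A k, ∃ y ∈ derivedSeries F A k, w = x * y}

/-- `A` is solvable if `A^(n) = 0` for some `n ≥ 1`. -/
def IsSolvable (F A : Type*) [Field F] [NonUnitalNonAssocRing A] [Module F A] : Prop :=
  ∃ n : ℕ, 1 ≤ n ∧ derivedSeries F A n = ⊥

end NonassocAlg

/-! The Leibniz identity makes x ↦ -R_x (R_x being right multiplication) respect brackets, so the
-R_x form a Lie algebra, and L is solvable once that algebra is. If it is not, it contains a simple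
subalgebra `s` acting on L.

The kernel Z of x ↦ R_x is an `s`-submodule, so Weyl's theorem gives an equivariant projection p
onto Z. Each a ∈ `s` equals -R_x with p x = 0. Then x * x = -(a x) lies in ker p by equivariance,
and in Z because R_x commutes with itself; so x * x = 0. Thus x lies in its own centralizer, an
ideal, whence (y * x) * x = 0 for all y, i.e. a² = 0. By Engel `s` is nilpotent, which is absurd.

The simple subalgebra is a minimal non-solvable one. A proper nonzero ideal would yield a nonzero
abelian ideal with simple quotient; a Levi-type argument (vanishing of first cohomology, via Casimir
operators) excludes this. -/

namespace LieAlgebra.IsSimple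

/-! ### Simple Lie algebras are perfect and not solvable. -/

variable {F s : Type*} [Field F] [LieRing s] [LieAlgebra F s] [IsSimple F s]

/-- A simple Lie algebra is perfect. -/
theorem lie_top_top : (⁅(⊤ : LieIdeal F s), (⊤ : LieIdeal F s)⁆ : LieIdeal F s) = ⊤ := by
  refine (eq_bot_or_eq_top (R := F) (L := s) _).resolve_left fun h => non_abelian F (L := s) ⟨?_⟩
  intro x y
  have : ⁅x, y⁆ ∈ (⁅(⊤ : LieIdeal F s), (⊤ : LieIdeal F s)⁆ : LieIdeal F s) :=
    LieSubmodule.lie_mem_lie (LieSubmodule.mem_top x) (LieSubmodule.mem_top y)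
  rwa [h, LieSubmodule.mem_bot] at this

theorem mem_of_forall_lie_mem (N : Submodule F s) (h : ∀ x y : s, ⁅x, y⁆ ∈ N) (x : s) :
    x ∈ N := by
  have hx : x ∈ (⁅(⊤ : LieIdeal F s), (⊤ : LieIdeal F s)⁆ : LieIdeal F s) := by
    rw [lie_top_top]; exact LieSubmodule.mem_top x
  rw [← LieSubmodule.mem_toSubmodule, LieSubmodule.lieIdeal_oper_eq_linear_span'] at hx
  refine Submodule.span_le.mpr ?_ hx
  rintro _ ⟨y, -, z, -, rfl⟩
  exact h y z

theorem not_isSolvable (F : Type*) {s : Type*} [Field F] [LieRing s] [LieAlgebra F s]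
    [IsSimple F s] : ¬ IsSolvable s := by
  intro h
  obtain ⟨k, hk⟩ := IsSolvable.solvable F s
  rw [LieIdeal.derivedSeries_eq_top k (lie_top_top (F := F))] at hk
  refine non_abelian F (L := s) ⟨fun x y => ?_⟩
  have : ⁅x, y⁆ ∈ (⊤ : LieIdeal F s) := LieSubmodule.mem_top _
  rwa [hk, LieSubmodule.mem_bot] at this

end LieAlgebra.IsSimple

/-! ### Casimir operators and invariants modulo an irreducible submodule. -/

namespace LieModule

open LieAlgebra

variable {F s V : Type*} [Field F] [LieRing s] [LieAlgebra F s]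
  [AddCommGroup V] [Module F V] [LieRingModule s V] [LieModule F s V]

section Casimir

variable {ι : Type*} [Fintype ι] (V)

/-- The operator `∑ i, b i * c i` attached to two families of elements of a Lie algebra; for dual
bases with respect to an invariant form this is the Casimir operator. -/
def casimir (b c : ι → s) : Module.End F V :=
  ∑ i, toEnd F s V (b i) ∘ₗ toEnd F s V (c i)

variable {V}

theorem casimir_apply (b c : ι → s) (v : V) :
    casimir (F := F) V b c v = ∑ i, ⁅b i, ⁅c i, v⁆⁆ := by
  simp [casimir]

/-- The Casimir operator attached to dual bases with respect to an invariant form commutes with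
the action of the Lie algebra. -/
theorem casimir_lie [DecidableEq ι] (B : LinearMap.BilinForm F s) (hB : B.Nondegenerate)
    (hs : B.IsSymm)
    (hinv : ∀ x y z : s, B ⁅x, y⁆ z = - B y ⁅x, z⁆) (b : Module.Basis ι F s) (x : s) (v : V) :
    casimir (F := F) V b (B.dualBasis hB b) ⁅x, v⁆ =
      ⁅x, casimir (F := F) V b (B.dualBasis hB b) v⁆ := by
  set c := B.dualBasis hB b
  have hrb (y : s) : y = ∑ j, B y (c j) • b j := by
    conv_lhs => rw [← b.sum_repr y]
    refine Finset.sum_congr rfl fun j _ => ?_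
    congr 1
    have := LinearMap.BilinForm.dualBasis_repr_apply hB c y j
    rwa [LinearMap.BilinForm.dualBasis_dualBasis hB hs b] at this
  have hrc (y : s) : y = ∑ j, B y (b j) • c j := by
    conv_lhs => rw [← c.sum_repr y]
    refine Finset.sum_congr rfl fun j _ => ?_
    rw [LinearMap.BilinForm.dualBasis_repr_apply hB b y j]
  -- By invariance, the matrices of ad x in the two dual bases are negative transposes of each
  -- other, so the double sums cancel.
  have key : ∑ i, ⁅⁅x, b i⁆, ⁅c i, v⁆⁆ + ∑ i, ⁅b i, ⁅⁅x, c i⁆, v⁆⁆ = 0 := by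
    have e1 : ∑ i, ⁅⁅x, b i⁆, ⁅c i, v⁆⁆ = ∑ i, ∑ j, B ⁅x, b i⁆ (c j) • ⁅b j, ⁅c i, v⁆⁆ := by
      refine Finset.sum_congr rfl fun i _ => ?_
      conv_lhs => rw [hrb ⁅x, b i⁆]
      simp [sum_lie]
    have e2 : ∑ i, ⁅b i, ⁅⁅x, c i⁆, v⁆⁆ = ∑ i, ∑ j, B ⁅x, c i⁆ (b j) • ⁅b i, ⁅c j, v⁆⁆ := by
      refine Finset.sum_congr rfl fun i _ => ?_
      conv_lhs => rw [hrc ⁅x, c i⁆]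
      simp [sum_lie, lie_sum]
    rw [e1, e2, Finset.sum_comm, ← Finset.sum_add_distrib]
    refine Finset.sum_eq_zero fun i _ => ?_
    rw [← Finset.sum_add_distrib]
    refine Finset.sum_eq_zero fun j _ => ?_
    rw [← add_smul, hinv, hs.eq (b j), neg_add_cancel, zero_smul]
  rw [casimir_apply, casimir_apply, lie_sum]
  have : ∀ i, ⁅x, ⁅b i, ⁅c i, v⁆⁆⁆ =
      ⁅b i, ⁅c i, ⁅x, v⁆⁆⁆ + (⁅⁅x, b i⁆, ⁅c i, v⁆⁆ + ⁅b i, ⁅⁅x, c i⁆, v⁆⁆) := by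
    intro i
    rw [leibniz_lie x (b i), leibniz_lie x (c i), lie_add]
    abel
  simp_rw [this]
  rw [Finset.sum_add_distrib, Finset.sum_add_distrib, key, add_zero]

end Casimir

/-- The radical of an invariant form is an ideal, hence zero or everything. -/
theorem traceForm_nondegenerate_of_ne_zero [IsSimple F s] (h : traceForm F s V ≠ 0) :
    (traceForm F s V).Nondegenerate := by
  set I := LieAlgebra.InvariantForm.orthogonal _ (traceForm_lieInvariant F s V) ⊤
  have key : I = ⊥ := by
    refine (IsSimple.eq_bot_or_eq_top (R := F) (L := s) I).resolve_right fun hT => h ?_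
    ext x y
    have : y ∈ I := hT ▸ LieSubmodule.mem_top y
    exact (LieAlgebra.InvariantForm.mem_orthogonal _ _ _ y).mp this x (LieSubmodule.mem_top x)
  have h1 : ∀ y, (∀ x, traceForm F s V x y = 0) → y = 0 := fun y hy => by
    have : y ∈ I := (LieAlgebra.InvariantForm.mem_orthogonal _ _ _ y).mpr fun x _ => hy x
    rwa [key, LieSubmodule.mem_bot] at this
  exact ⟨fun x hx => h1 x fun y => by rw [traceForm_comm]; exact hx y, h1⟩

/-- By Cartan's criterion the derived algebra, here all of `s`, acts nilpotently. So nonzero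
invariants exist, and irreducibility makes them everything. -/
theorem isTrivial_of_traceForm_eq_zero [CharZero F] [FiniteDimensional F V] [IsSimple F s]
    [IsIrreducible F s V] (h : traceForm F s V = 0) : IsTrivial s V := by
  have h1 := isNilpotent_derivedSeries_of_traceForm_eq_zero h
  have hn : IsNilpotent s V := by
    rw [isNilpotent_iff_forall' (R := F)] at h1 ⊢
    intro x
    exact h1 ⟨x, (show derivedSeries F s 1 = ⊤ from IsSimple.lie_top_top) ▸ LieSubmodule.mem_top x⟩
  have : Nontrivial V := (LieSubmodule.nontrivial_iff F s V).mp inferInstance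
  have := nontrivial_max_triv_of_isNilpotent F s V
  have ht := LieSubmodule.eq_top_of_isIrreducible F s V (maxTrivSubmodule F s V)
  exact (isTrivial_iff_max_triv_eq_top F s V).mpr ht

/-- Vanishing of obstructions to invariants for irreducible submodules. -/
theorem exists_mem_forall_lie_sub_eq_zero_of_isIrreducible [CharZero F]
    [FiniteDimensional F s] [IsSimple F s]
    (W : LieSubmodule F s V) [FiniteDimensional F W] [IsIrreducible F s W] (v : V)
    (hv : ∀ x : s, ⁅x, v⁆ ∈ W) : ∃ w ∈ W, ∀ x : s, ⁅x, v - w⁆ = 0 := by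
  classical
  by_cases h : traceForm F s W = 0
  · have ht := isTrivial_of_traceForm_eq_zero h
    have h0 : ∀ (x : s), ∀ w ∈ W, ⁅x, w⁆ = 0 := fun x w hw => by
      simpa using congrArg Subtype.val (ht.trivial x ⟨w, hw⟩)
    refine ⟨0, W.zero_mem, fun x => ?_⟩
    rw [sub_zero]
    -- ⁅y, z⁆ kills v because y and z send v into W, on which `s` acts as zero; perfectness covers
    -- the rest of `s`.
    refine IsSimple.mem_of_forall_lie_mem
      (LinearMap.ker ((toEnd F s V : s →ₗ[F] Module.End F V).flip v)) (fun y z => ?_) x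
    simp [h0 _ _ (hv _)]
  · have hB := traceForm_nondegenerate_of_ne_zero h
    have hs : (traceForm F s W).IsSymm := ⟨traceForm_comm F s W⟩
    have hinv : ∀ x y z : s, traceForm F s W ⁅x, y⁆ z = - traceForm F s W y ⁅x, z⁆ :=
      traceForm_lieInvariant F s W
    let b := Module.finBasis F s
    let c := (traceForm F s W).dualBasis hB b
    let Ω : Module.End F V := casimir V b c
    let ω : Module.End F W := casimir W b c
    have hΩω (w : W) : Ω w = ω w := by simp [Ω, ω, casimir_apply]
    have hΩ (x : s) (u : V) : Ω ⁅x, u⁆ = ⁅x, Ω u⁆ := casimir_lie _ hB hs hinv b x u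
    have hω (x : s) (u : W) : ω ⁅x, u⁆ = ⁅x, ω u⁆ := casimir_lie _ hB hs hinv b x u
    -- Each dual pair contributes 1. The trace is thus nonzero in characteristic zero, and
    -- irreducibility makes ω injective.
    have htr : LinearMap.trace F W ω = Module.finrank F s := by
      simp only [ω, casimir, map_sum]
      have : ∀ i, LinearMap.trace F W (toEnd F s W (b i) ∘ₗ toEnd F s W (c i)) = 1 := fun i => by
        rw [← traceForm_apply_apply]
        simpa using LinearMap.BilinForm.apply_dualBasis_right hB hs b i i
      simp [this]
    have hω0 : ω ≠ 0 := by
      intro h0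
      rw [h0, map_zero, eq_comm, Nat.cast_eq_zero, Module.finrank_zero_iff] at htr
      exact IsSimple.non_abelian F (L := s) ⟨fun x y => Subsingleton.elim _ _⟩
    let K : LieSubmodule F s W := LieModuleHom.ker { ω with map_lie' := fun {x u} => hω x u }
    have hK : K = ⊥ := by
      refine (eq_bot_or_eq_top K).resolve_right fun hT => hω0 (LinearMap.ext fun u => ?_)
      have : u ∈ K := hT ▸ LieSubmodule.mem_top u
      exact this
    have hinj : Function.Injective ω := by
      rw [injective_iff_map_eq_zero]
      intro u hu
      have : u ∈ K := hu
      rwa [hK, LieSubmodule.mem_bot] at this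
    have hΩv : Ω v ∈ W := by
      simp only [Ω, casimir_apply]
      exact sum_mem fun i _ => W.lie_mem (hv _)
    -- With Ω (v - w) = 0, ω kills each ⁅x, v - w⁆ ∈ W, which must then vanish.
    obtain ⟨w, hw⟩ := (LinearMap.injective_iff_surjective.mp hinj) ⟨Ω v, hΩv⟩
    refine ⟨w, w.2, fun x => ?_⟩
    have hmem : ⁅x, v - (w : V)⁆ ∈ W := by
      rw [lie_sub]; exact sub_mem (hv x) (W.lie_mem w.2)
    have : ω ⟨_, hmem⟩ = 0 := by
      apply Subtype.ext
      rw [← hΩω]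
      simp [hΩ, hΩω, hw]
    simpa using congrArg Subtype.val ((injective_iff_map_eq_zero ω).mp hinj _ this)

end LieModule

/-- Every subspace is the image of a linear projection. -/
theorem Submodule.exists_isProj {F V : Type*} [Field F] [AddCommGroup V] [Module F V]
    (W : Submodule F V) : ∃ π : V →ₗ[F] V, LinearMap.IsProj W π := by
  obtain ⟨f, hf⟩ := W.subtype.exists_leftInverse_of_injective W.ker_subtype
  exact ⟨W.subtype ∘ₗ f, fun v => (f v).2, fun w hw =>
    congrArg Subtype.val (LinearMap.congr_fun hf ⟨w, hw⟩)⟩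

/-! ### Invariants modulo any submodule, and Weyl's complete reducibility. -/

namespace LieModule

open LieAlgebra

universe u

/-- Over a simple Lie algebra of characteristic zero, a vector which is invariant modulo a
finite-dimensional submodule can be corrected to an invariant vector. -/
theorem exists_mem_forall_lie_sub_eq_zero {F s : Type*} {V : Type u} [Field F] [CharZero F]
    [LieRing s] [LieAlgebra F s] [FiniteDimensional F s] [IsSimple F s]
    [AddCommGroup V] [Module F V] [LieRingModule s V] [LieModule F s V] [FiniteDimensional F V]
    (W : LieSubmodule F s V) (v : V) (hv : ∀ x : s, ⁅x, v⁆ ∈ W) :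
    ∃ w ∈ W, ∀ x : s, ⁅x, v - w⁆ = 0 := by
  induction hn : Module.finrank F W using Nat.strong_induction_on generalizing V with
  | _ n ih =>
    by_cases hW : W = ⊥
    · subst hW
      exact ⟨0, zero_mem _, fun x => by simpa using hv x⟩
    by_cases hirr : ∀ N : LieSubmodule F s V, N ≤ W → N = ⊥ ∨ N = W
    · have : Nontrivial W := (LieSubmodule.nontrivial_iff_ne_bot F s V).mpr hW
      have : IsIrreducible F s W := IsIrreducible.mk fun N hN => by
        rcases hirr (N.map W.incl) (LieSubmodule.map_incl_le) with h | h
        · refine absurd ((LieSubmodule.eq_bot_iff N).mpr fun x hx => Subtype.ext ?_) hN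
          have hx' : W.incl x ∈ N.map W.incl := LieSubmodule.mem_map_of_mem hx
          rwa [h, LieSubmodule.mem_bot] at hx'
        · rw [eq_top_iff]
          rintro ⟨x, hx⟩ -
          rw [← h] at hx
          obtain ⟨y, hy, rfl⟩ := (LieSubmodule.mem_map _).mp hx
          exact hy
      exact exists_mem_forall_lie_sub_eq_zero_of_isIrreducible W v hv
    · push Not at hirr
      -- Correct v by W / N in the quotient by N, then correct the remaining error inside N; both
      -- have smaller dimension than W.
      obtain ⟨N, hNW, hN0, hNW'⟩ := hirr
      have hlt : N < W := lt_of_le_of_ne hNW hNW'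
      let q := LieSubmodule.Quotient.mk' N
      have hcard : Module.finrank F (W.map q) < n := by
        have h1 := (q.toLinearMap.domRestrict W.toSubmodule).finrank_range_add_finrank_ker
        have h2 : LinearMap.range (q.toLinearMap.domRestrict W.toSubmodule) =
            (W.map q).toSubmodule := by
          rw [LinearMap.range_domRestrict]; rfl
        rw [h2] at h1
        have h3 : 0 < Module.finrank F
            (LinearMap.ker (q.toLinearMap.domRestrict W.toSubmodule)) := by
          rw [Module.finrank_pos_iff, Submodule.nontrivial_iff_ne_bot, Submodule.ne_bot_iff]
          obtain ⟨x, hx, hx0⟩ := (Submodule.ne_bot_iff N.toSubmodule).mp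
            (by simpa using hN0)
          refine ⟨⟨x, hNW hx⟩, ?_, by simpa using hx0⟩
          simpa [q] using hx
        have h4 : Module.finrank F W.toSubmodule = n := hn
        have h5 : Module.finrank F (W.map q).toSubmodule = Module.finrank F (W.map q) := rfl
        omega
      obtain ⟨w', hw', hw''⟩ := ih _ hcard (W.map q) (q v)
        (fun x => by
          rw [← q.map_lie]
          exact LieSubmodule.mem_map_of_mem (hv x)) rfl
      obtain ⟨w, hw, rfl⟩ := (LieSubmodule.mem_map _).mp hw'
      obtain ⟨z, hz, hz'⟩ := ih _ (hn ▸ Submodule.finrank_lt_finrank_of_lt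
        (show N.toSubmodule < W.toSubmodule from hlt)) N (v - w)
        (fun x => by
          have := hw'' x
          rw [← map_sub, ← q.map_lie] at this
          exact (LieSubmodule.Quotient.mk_eq_zero _).mp this) rfl
      refine ⟨w + z, add_mem hw (hNW hz), fun x => ?_⟩
      rw [← sub_sub]
      exact hz' x

/-- Over a simple Lie algebra of characteristic zero, every submodule is the image of an
equivariant projection. -/
theorem exists_equivariant_projection {F s V : Type*} [Field F] [CharZero F]
    [LieRing s] [LieAlgebra F s] [FiniteDimensional F s] [IsSimple F s]
    [AddCommGroup V] [Module F V] [LieRingModule s V] [LieModule F s V] [FiniteDimensional F V]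
    (W : LieSubmodule F s V) :
    ∃ p : V →ₗ[F] V, (∀ v, p v ∈ W) ∧ (∀ w ∈ W, p w = w) ∧ ∀ (x : s) v, p ⁅x, v⁆ = ⁅x, p v⁆ := by
  obtain ⟨π, hπ⟩ := W.toSubmodule.exists_isProj
  -- Subtracting an element of N from a projection onto W leaves a projection onto W, and every ⁅x,
  -- π⁆ lies in N.
  let N : LieSubmodule F s (V →ₗ[F] V) :=
    { carrier := {f | (∀ v, f v ∈ W) ∧ ∀ w ∈ W, f w = 0}
      zero_mem' := ⟨fun _ => W.zero_mem, fun _ _ => rfl⟩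
      add_mem' := fun {f g} hf hg => ⟨fun v => add_mem (hf.1 v) (hg.1 v), fun w hw => by
        simp [hf.2 w hw, hg.2 w hw]⟩
      smul_mem' := fun c f hf => ⟨fun v => W.smul_mem c (hf.1 v), fun w hw => by
        simp [hf.2 w hw]⟩
      lie_mem := fun {x f} hf => ⟨fun v => by
          rw [LieHom.lie_apply]; exact sub_mem (W.lie_mem (hf.1 v)) (hf.1 _), fun w hw => by
        rw [LieHom.lie_apply, hf.2 w hw, hf.2 _ (W.lie_mem hw)]; simp⟩ }
  obtain ⟨f, hf, hf'⟩ := exists_mem_forall_lie_sub_eq_zero N π fun x => by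
    refine ⟨fun v => ?_, fun w hw => ?_⟩
    · rw [LieHom.lie_apply]
      exact sub_mem (W.lie_mem (hπ.map_mem v)) (hπ.map_mem _)
    · rw [LieHom.lie_apply, hπ.map_id w hw, hπ.map_id _ (W.lie_mem hw), sub_self]
  refine ⟨π - f, fun v => sub_mem (hπ.map_mem v) (hf.1 v), fun w hw => ?_, fun x v => ?_⟩
  · rw [LinearMap.sub_apply, hπ.map_id w hw, hf.2 w hw, sub_zero]
  · have := LinearMap.congr_fun (hf' x) v
    rw [LieHom.lie_apply, LinearMap.zero_apply, sub_eq_zero] at this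
    exact this.symm

/-! ### Passing to modules over a simple quotient. -/

section QuotientAction

variable {F g V : Type*} [Field F] [LieRing g] [LieAlgebra F g]
  [AddCommGroup V] [Module F V] [LieRingModule g V] [LieModule F g V]
  (A : LieIdeal F g) (hA : ∀ a ∈ A, ∀ v : V, ⁅a, v⁆ = 0)

/-- A module on which an ideal `A` acts trivially is a module over the quotient by `A`. -/
abbrev quotientLieRingModule : LieRingModule (g ⧸ A) V where
  bracket x v := A.toSubmodule.liftQ (toEnd F g V : g →ₗ[F] Module.End F V)
    (fun a ha => LinearMap.ext fun v => hA a ha v) x v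
  add_lie x y v := by simp
  lie_add x v w := by simp
  leibniz_lie x y v := by
    induction x using Submodule.Quotient.induction_on
    induction y using Submodule.Quotient.induction_on
    exact leibniz_lie _ _ _

theorem quotientLieModule :
    letI := quotientLieRingModule A hA
    LieModule F (g ⧸ A) V :=
  letI := quotientLieRingModule A hA
  { smul_lie := fun t x v => by
      induction x using Submodule.Quotient.induction_on
      exact smul_lie t (_ : g) v
    lie_smul := fun t x v => by
      induction x using Submodule.Quotient.induction_on
      exact lie_smul t (_ : g) v }

/-- A relative version of `LieModule.exists_mem_forall_lie_sub_eq_zero`: the quotient by an ideal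
`A` is simple, and `A` acts trivially modulo a submodule `P`. -/
theorem exists_mem_forall_lie_sub_mem [CharZero F] [FiniteDimensional F g] [FiniteDimensional F V]
    [IsSimple F (g ⧸ A)] (P W : LieSubmodule F g V) (hP : ∀ a ∈ A, ∀ v : V, ⁅a, v⁆ ∈ P)
    (v : V) (hv : ∀ x : g, ⁅x, v⁆ ∈ W) : ∃ w ∈ W, ∀ x : g, ⁅x, v - w⁆ ∈ P := by
  let q := LieSubmodule.Quotient.mk' P
  have hA : ∀ a ∈ A, ∀ v : V ⧸ P, ⁅a, v⁆ = 0 := fun a ha v => by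
    obtain ⟨v, rfl⟩ := LieSubmodule.Quotient.surjective_mk' P v
    rw [← LieModuleHom.map_lie]
    exact (LieSubmodule.Quotient.mk_eq_zero _).mpr (hP a ha v)
  let _ := quotientLieRingModule A hA
  have := quotientLieModule A hA
  let W' : LieSubmodule F (g ⧸ A) (V ⧸ P) :=
    { (W.map q).toSubmodule with
      lie_mem := fun {x m} hm => by
        induction x using Submodule.Quotient.induction_on
        exact (W.map q).lie_mem hm }
  have hfin : FiniteDimensional F (V ⧸ P) :=
    inferInstanceAs (FiniteDimensional F (V ⧸ P.toSubmodule))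
  have hfin' : FiniteDimensional F (g ⧸ A) :=
    inferInstanceAs (FiniteDimensional F (g ⧸ A.toSubmodule))
  obtain ⟨w', hw', hw''⟩ := exists_mem_forall_lie_sub_eq_zero W' (q v) fun x => by
    induction x using Submodule.Quotient.induction_on with
    | _ x => exact LieSubmodule.mem_map_of_mem (f := q) (hv x)
  obtain ⟨w, hw, rfl⟩ := (LieSubmodule.mem_map _).mp (show w' ∈ W.map q from hw')
  refine ⟨w, hw, fun x => ?_⟩
  have : q ⁅x, v - w⁆ = 0 := by
    rw [LieModuleHom.map_lie, map_sub]
    exact hw'' (LieSubmodule.Quotient.mk x)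
  exact (LieSubmodule.Quotient.mk_eq_zero _).mp this

end QuotientAction

end LieModule

/-! ### Abelian ideals with simple quotient. -/

namespace LieAlgebra

section AbelianIdeal

variable {F g : Type*} [Field F] [LieRing g] [LieAlgebra F g] (A : LieIdeal F g)

/-- The quotient map by an ideal, as a morphism of Lie algebras. -/
def quotientHom : g →ₗ⁅F⁆ g ⧸ A :=
  { A.toSubmodule.mkQ with map_lie' := rfl }

theorem quotientHom_surjective : Function.Surjective (quotientHom A) :=
  A.toSubmodule.mkQ_surjective

/-- If a solvable subalgebra meets every coset of an ideal, then the quotient is solvable. -/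
theorem isSolvable_quotient_of_forall_exists_sub_mem (B : LieSubalgebra F g) [IsSolvable B]
    (h : ∀ x : g, ∃ b ∈ B, x - b ∈ A) : IsSolvable (g ⧸ A) := by
  have : Function.Surjective ((quotientHom A).comp B.incl) := by
    intro y
    obtain ⟨x, rfl⟩ := quotientHom_surjective A y
    obtain ⟨b, hb, hx⟩ := h x
    exact ⟨⟨b, hb⟩, ((Submodule.Quotient.eq A.toSubmodule).mpr hx).symm⟩
  exact this.lieAlgebra_isSolvable

/-- The module of linear maps into an ideal which act on that ideal by a scalar. -/
def scalarMaps : LieSubmodule F g (g →ₗ[F] g) where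
  carrier := {f | (∀ x, f x ∈ A) ∧ ∃ c : F, ∀ a ∈ A, f a = c • a}
  zero_mem' := ⟨fun _ => A.zero_mem, 0, fun a _ => by simp⟩
  add_mem' := by
    rintro f f' ⟨hf, c, hc⟩ ⟨hf', c', hc'⟩
    exact ⟨fun x => add_mem (hf x) (hf' x), c + c', fun a ha => by
      rw [LinearMap.add_apply, hc a ha, hc' a ha, add_smul]⟩
  smul_mem' := by
    rintro t f ⟨hf, c, hc⟩
    exact ⟨fun x => A.smul_mem t (hf x), t * c, fun a ha => by
      rw [LinearMap.smul_apply, hc a ha, mul_smul]⟩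
  lie_mem := by
    rintro x f ⟨hf, c, hc⟩
    refine ⟨fun y => ?_, 0, fun a ha => ?_⟩
    · rw [LieHom.lie_apply]
      exact sub_mem (A.lie_mem (hf y)) (hf _)
    · rw [LieHom.lie_apply, hc a ha, hc _ (A.lie_mem ha), lie_smul, sub_self, zero_smul]

/-- The maps in `scalarMaps A` which vanish on `A`. -/
def scalarMapsVanishing : LieSubmodule F g (scalarMaps A) where
  carrier := {f | ∀ a ∈ A, f.1 a = 0}
  zero_mem' := fun _ _ => rfl
  add_mem' := fun {f f'} hf hf' a ha => by
    simp [hf a ha, hf' a ha]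
  smul_mem' := fun t f hf a ha => by simp [hf a ha]
  lie_mem := fun {x f} hf a ha => by
    rw [LieSubmodule.coe_bracket, LieHom.lie_apply, hf a ha, hf _ (A.lie_mem ha)]
    simp

/-- The maps in `scalarMaps A` which are adjoint actions of elements of `A`. -/
def scalarMapsInner : LieSubmodule F g (scalarMaps A) where
  carrier := {f | ∃ a ∈ A, ∀ y, f.1 y = ⁅a, y⁆}
  zero_mem' := ⟨0, A.zero_mem, fun y => by simp⟩
  add_mem' := by
    rintro f f' ⟨a, ha, h⟩ ⟨a', ha', h'⟩
    exact ⟨a + a', add_mem ha ha', fun y => by simp [h, h']⟩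
  smul_mem' := by
    rintro t f ⟨a, ha, h⟩
    exact ⟨t • a, A.smul_mem t ha, fun y => by simp [h]⟩
  lie_mem := by
    rintro x f ⟨a, ha, h⟩
    refine ⟨⁅x, a⁆, A.lie_mem ha, fun y => ?_⟩
    rw [LieSubmodule.coe_bracket, LieHom.lie_apply, h, h, lie_lie]

variable {A}

/-- Over an abelian ideal with simple quotient there is a projection whose failure to be
equivariant is inner. -/
theorem exists_projection_lie_eq_inner [CharZero F] [FiniteDimensional F g] [IsSimple F (g ⧸ A)]
    (hA : ∀ a ∈ A, ∀ b ∈ A, ⁅a, b⁆ = 0) :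
    ∃ f : g →ₗ[F] g, (∀ x, f x ∈ A) ∧ (∀ a ∈ A, f a = a) ∧
      ∀ x : g, ∃ a ∈ A, ∀ y, ⁅x, f y⁆ - f ⁅x, y⁆ = ⁅a, y⁆ := by
  obtain ⟨π, hπ⟩ := A.toSubmodule.exists_isProj
  have hπ1 : ∀ a ∈ A, π a = a := hπ.map_id
  let v : scalarMaps A := ⟨π, hπ.map_mem, 1, fun a ha => by rw [hπ1 a ha, one_smul]⟩
  have : FiniteDimensional F (scalarMaps A) :=
    inferInstanceAs (FiniteDimensional F (scalarMaps A).toSubmodule)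
  -- For a ∈ A and f acting on A as the scalar c, ⁅a, f⁆ = -c ad a is inner: so A acts trivially
  -- modulo `scalarMapsInner`.
  obtain ⟨w, hw, hvw⟩ := LieModule.exists_mem_forall_lie_sub_mem A (scalarMapsInner A)
    (scalarMapsVanishing A) (fun a ha f => by
      obtain ⟨f, hf, c, hc⟩ := f
      refine ⟨-(c • a), neg_mem (A.smul_mem c ha), fun y => ?_⟩
      rw [LieSubmodule.coe_bracket, LieHom.lie_apply, hA a ha _ (hf y), zero_sub,
        hc _ (lie_mem_left F g A a y ha), neg_lie, smul_lie])
    v (fun x a ha => by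
      rw [LieSubmodule.coe_bracket, LieHom.lie_apply]
      simp only [v]
      rw [hπ1 a ha, hπ1 _ (A.lie_mem ha), sub_self])
  refine ⟨(v - w).1, (v - w).2.1, fun a ha => ?_, fun x => ?_⟩
  · have h0 : w.1 a = 0 := hw a ha
    simp [v, h0, hπ1 a ha]
  · obtain ⟨a, ha, h⟩ := hvw x
    exact ⟨a, ha, h⟩

/-- If all proper subalgebras are solvable, then no nonzero abelian ideal has simple quotient. -/
theorem eq_bot_of_isSimple_quotient [CharZero F] [FiniteDimensional F g] [IsSimple F (g ⧸ A)]
    (hA : ∀ a ∈ A, ∀ b ∈ A, ⁅a, b⁆ = 0)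
    (h : ∀ B : LieSubalgebra F g, B ≠ ⊤ → IsSolvable B) : A = ⊥ := by
  have hns : ¬ IsSolvable (g ⧸ A) := IsSimple.not_isSolvable F
  have hfull : ∀ B : LieSubalgebra F g, (∀ x : g, ∃ b ∈ B, x - b ∈ A) → B = ⊤ := by
    intro B hB
    by_contra hne
    have := h B hne
    exact hns (isSolvable_quotient_of_forall_exists_sub_mem A B hB)
  obtain ⟨f, hfA, hfid, hf⟩ := exists_projection_lie_eq_inner hA
  -- B consists of the x whose adjoint action commutes with f. Correcting x by its inner error in A
  -- puts it in B, so B meets every coset of A.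
  let B : LieSubalgebra F g :=
    { carrier := {x | ∀ y, ⁅x, f y⁆ = f ⁅x, y⁆}
      zero_mem' := fun y => by simp
      add_mem' := fun {x x'} hx hx' y => by rw [add_lie, add_lie, map_add, hx y, hx' y]
      smul_mem' := fun t x hx y => by rw [smul_lie, smul_lie, map_smul, hx y]
      lie_mem' := fun {x x'} hx hx' y => by
        rw [lie_lie, lie_lie, map_sub, hx' y, hx y, hx, hx'] }
  have hB : B = ⊤ := hfull B fun x => by
    obtain ⟨a, ha, hxa⟩ := hf x
    refine ⟨x + a, fun y => ?_, by simpa using ha⟩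
    rw [add_lie, add_lie, map_add, hA a ha _ (hfA y), hfid _ (lie_mem_left F g A a y ha), ← hxa y]
    abel
  have heq (x y : g) : ⁅x, f y⁆ = f ⁅x, y⁆ := (hB ▸ LieSubalgebra.mem_top x : x ∈ B) y
  have hcentral (a : g) (ha : a ∈ A) (y : g) : ⁅a, y⁆ = 0 := by
    rw [← hfid _ (lie_mem_left F g A a y ha), ← heq, hA a ha _ (hfA y)]
  have hlie (x y : g) : f ⁅x, y⁆ = 0 := by
    rw [← heq, ← lie_skew, hcentral _ (hfA y), neg_zero]
  -- f is now equivariant, which makes A central and f zero on brackets. Its kernel is a subalgebra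
  -- meeting every coset of A, hence everything, although f is the identity on A.
  let K : LieSubalgebra F g := { LinearMap.ker f with lie_mem' := fun {x y} _ _ => hlie x y }
  have hK : K = ⊤ := hfull K fun x => by
    refine ⟨x - f x, ?_, by simpa using hfA x⟩
    change f (x - f x) = 0
    rw [map_sub, hfid _ (hfA x), sub_self]
  rw [LieSubmodule.eq_bot_iff]
  intro a ha
  rw [← hfid a ha]
  exact (hK ▸ LieSubalgebra.mem_top a : a ∈ K)

end AbelianIdeal

-- Minimal non-solvable subalgebras are simple.

universe u

/-- In characteristic zero, a non-solvable Lie algebra all of whose proper subalgebras are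
solvable is simple. -/
theorem isSimple_of_forall_isSolvable {F : Type*} {g : Type u} [Field F] [CharZero F] [LieRing g]
    [LieAlgebra F g] [FiniteDimensional F g] (hg : ¬ IsSolvable g)
    (h : ∀ B : LieSubalgebra F g, B ≠ ⊤ → IsSolvable B) : IsSimple F g := by
  induction hn : Module.finrank F g using Nat.strong_induction_on generalizing g with
  | _ n ih =>
    refine ⟨fun J => ?_, fun hab => hg inferInstance⟩
    by_contra hJ
    push Not at hJ
    obtain ⟨hJ0, hJ1⟩ := hJ
    have hJs : IsSolvable J := h J.toLieSubalgebra fun hT => hJ1 <| by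
      rw [eq_top_iff]
      intro x _
      have : x ∈ J.toLieSubalgebra := hT ▸ LieSubalgebra.mem_top x
      exact this
    -- The last nonzero term of the derived series of J. The quotient by it inherits both
    -- hypotheses, so it is simple by induction.
    let A := derivedAbelianOfIdeal J
    have hA0 : A ≠ ⊥ := fun h0 => hJ0 ((abelian_of_solvable_ideal_eq_bot_iff J).mp h0)
    have hAab : IsLieAbelian A := abelian_derivedAbelianOfIdeal J
    have hA : ∀ a ∈ A, ∀ b ∈ A, ⁅a, b⁆ = 0 := fun a ha b hb =>
      congrArg Subtype.val (hAab.trivial ⟨a, ha⟩ ⟨b, hb⟩)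
    have hfin : FiniteDimensional F (g ⧸ A) :=
      inferInstanceAs (FiniteDimensional F (g ⧸ A.toSubmodule))
    have hlt : Module.finrank F (g ⧸ A) < n := by
      have h1 := A.toSubmodule.finrank_quotient_add_finrank
      have h2 : 0 < Module.finrank F A.toSubmodule := by
        rw [Module.finrank_pos_iff, Submodule.nontrivial_iff_ne_bot]
        simpa using hA0
      have h3 : Module.finrank F (g ⧸ A.toSubmodule) = Module.finrank F (g ⧸ A) := rfl
      omega
    have hsub : ∀ B : LieSubalgebra F (g ⧸ A), B ≠ ⊤ → IsSolvable B := by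
      intro B hB
      let q := quotientHom A
      have hC : B.comap q ≠ ⊤ := fun hT => hB <| by
        rw [eq_top_iff]
        intro y _
        obtain ⟨x, rfl⟩ := quotientHom_surjective A y
        exact (hT ▸ LieSubalgebra.mem_top x : x ∈ B.comap q)
      have := h _ hC
      let r : B.comap q →ₗ⁅F⁆ B :=
        { toFun := fun x => ⟨q x, x.2⟩
          map_add' := fun x y => Subtype.ext (map_add q _ _)
          map_smul' := fun t x => Subtype.ext (map_smul q _ _)
          map_lie' := fun {x y} => Subtype.ext (LieHom.map_lie q _ _) }
      have hr : Function.Surjective r := by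
        rintro ⟨y, hy⟩
        obtain ⟨x, rfl⟩ := quotientHom_surjective A y
        exact ⟨⟨x, hy⟩, rfl⟩
      exact hr.lieAlgebra_isSolvable
    have hns : ¬ IsSolvable (g ⧸ A) := by
      intro hs
      obtain ⟨k, hk⟩ := IsSolvable.solvable F (g ⧸ A)
      have hle : derivedSeries F g k ≤ A := by
        intro x hx
        have := LieIdeal.derivedSeries_map_le (f := quotientHom A) k
          (LieIdeal.mem_map (f := quotientHom A) hx)
        rw [hk, LieSubmodule.mem_bot] at this
        exact (Submodule.Quotient.mk_eq_zero A.toSubmodule).mp this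
      refine hg (IsSolvable.mk (R := F) (k := 1 + k) ?_)
      rw [derivedSeries_def, derivedSeriesOfIdeal_add, ← derivedSeries_def F g k, eq_bot_iff]
      refine (derivedSeriesOfIdeal_mono hle 1).trans (le_of_eq ?_)
      exact (abelian_iff_derived_one_eq_bot A).mp hAab
    have := ih _ hlt hns hsub rfl
    exact hA0 (eq_bot_of_isSimple_quotient hA h)

/-- In characteristic zero, a non-solvable Lie algebra has a simple subalgebra. -/
theorem exists_isSimple_subalgebra (F : Type*) {g : Type*} [Field F] [CharZero F] [LieRing g]
    [LieAlgebra F g] [FiniteDimensional F g] (hg : ¬ IsSolvable g) :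
    ∃ s : LieSubalgebra F g, IsSimple F s := by
  have : WellFoundedLT (LieSubalgebra F g) := RelHomClass.isWellFounded
    (⟨LieSubalgebra.toSubmodule, @fun _ _ h => h⟩ :
      ((· < ·) : LieSubalgebra F g → LieSubalgebra F g → Prop) →r
        ((· < ·) : Submodule F g → Submodule F g → Prop))
  obtain ⟨s, hs, hmin⟩ := exists_minimal_of_wellFoundedLT
    (fun s : LieSubalgebra F g => ¬ IsSolvable s) ⟨⊤, fun h =>
      hg ((solvable_iff_equiv_solvable LieSubalgebra.topEquiv (R := F)).mp h)⟩
  refine ⟨s, isSimple_of_forall_isSolvable hs fun B hB => ?_⟩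
  by_contra hBs
  let r : B →ₗ⁅F⁆ B.map s.incl :=
    { toFun := fun x => ⟨s.incl x, (LieSubalgebra.mem_map _ _ _).mpr ⟨x, x.2, rfl⟩⟩
      map_add' := fun _ _ => rfl
      map_smul' := fun _ _ => rfl
      map_lie' := fun {_ _} => rfl }
  have hr : Function.Injective r := fun x y hxy =>
    Subtype.ext (Subtype.ext (congrArg (fun z : B.map s.incl => (z : g)) hxy))
  have hle : B.map s.incl ≤ s := by
    rintro _ ⟨x, -, rfl⟩
    exact x.2
  have hge := hmin (y := B.map s.incl) (fun h => hBs hr.lieAlgebra_isSolvable) hle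
  refine hB (eq_top_iff.mpr fun x _ => ?_)
  obtain ⟨y, hy, hyx⟩ := (LieSubalgebra.mem_map _ _ _).mp (hge x.2)
  rwa [← Subtype.ext hyx]

end LieAlgebra

/-! ### Leibniz algebras and their right multiplications. -/

namespace NonassocAlg

open LieAlgebra

attribute [local instance] LieRing.ofAssociativeRing

variable {F L : Type*} [Field F] [NonUnitalNonAssocRing L] [Module F L] [IsScalarTower F L L]
  [SMulCommClass F L L]

variable (F) in
/-- The negative of right multiplication; for a Leibniz algebra this respects brackets. -/
def negMulRight : L →ₗ[F] Module.End F L := -(LinearMap.mul F L).flip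

@[simp]
theorem negMulRight_apply (x y : L) : negMulRight F x y = -(y * x) := rfl

theorem negMulRight_mul (h : IsLeibniz L) (x y : L) :
    negMulRight F (x * y) = ⁅negMulRight F x, negMulRight F y⁆ := by
  ext z
  simp [LieRing.of_associative_ring_bracket, h z x y]

/-- The Lie algebra of right multiplications of a Leibniz algebra. -/
def rightMultiplications (F : Type*) {L : Type*} [Field F] [NonUnitalNonAssocRing L] [Module F L]
    [IsScalarTower F L L] [SMulCommClass F L L] (h : IsLeibniz L) :
    LieSubalgebra F (Module.End F L) :=
  { LinearMap.range (negMulRight F (L := L)) with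
    lie_mem' := by
      rintro _ _ ⟨x, rfl⟩ ⟨y, rfl⟩
      exact ⟨x * y, negMulRight_mul h x y⟩ }

theorem negMulRight_mem (h : IsLeibniz L) (x : L) : negMulRight F x ∈ rightMultiplications F h :=
  ⟨x, rfl⟩

/-- A Leibniz algebra is solvable if its Lie algebra of right multiplications is. -/
theorem isSolvable_of_isSolvable_rightMultiplications (h : IsLeibniz L)
    [hs : LieAlgebra.IsSolvable (rightMultiplications F h)] : IsSolvable F L := by
  have key : ∀ k, ∀ x ∈ derivedSeries F L k, (⟨negMulRight F x, negMulRight_mem h x⟩ :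
      rightMultiplications F h) ∈ LieAlgebra.derivedSeries F (rightMultiplications F h) k := by
    intro k
    induction k with
    | zero => exact fun x _ => LieSubmodule.mem_top _
    | succ k ih =>
      intro x hx
      let T : L →ₗ[F] rightMultiplications F h :=
        (negMulRight F).codRestrict (rightMultiplications F h).toSubmodule (negMulRight_mem h)
      refine (Submodule.span_le (p := (LieAlgebra.derivedSeries F (rightMultiplications F h)
        (k + 1)).toSubmodule.comap T)).mpr ?_ hx
      rintro _ ⟨y, hy, z, hz, rfl⟩
      have hT : T (y * z) = ⁅T y, T z⁆ := Subtype.ext (negMulRight_mul h y z)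
      change T (y * z) ∈ LieAlgebra.derivedSeries F (rightMultiplications F h) (k + 1)
      rw [hT, derivedSeries_def, derivedSeriesOfIdeal_succ]
      exact LieSubmodule.lie_mem_lie (ih y hy) (ih z hz)
  obtain ⟨k, hk⟩ := IsSolvable.solvable F (rightMultiplications F h)
  -- Vanishing of the k-th term upstairs only says that L^(k) multiplies to zero from the right; one
  -- more step kills the products.
  refine ⟨k + 1, by omega, ?_⟩
  rw [derivedSeries, Submodule.span_eq_bot]
  rintro _ ⟨x, -, y, hy, rfl⟩
  have h0 := key k y hy
  rw [hk, LieSubmodule.mem_bot] at h0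
  have h1 : negMulRight F y = 0 := congrArg Subtype.val h0
  simpa using LinearMap.congr_fun h1 x

/-- In a Leibniz algebra all of whose centralizers are ideals, right multiplication by an element
of square zero has square zero. -/
theorem IsCL.mul_mul_self_eq_zero (h : IsCL F L) {x : L} (hx : x * x = 0) (y : L) :
    y * x * x = 0 :=
  (h x x ⟨hx, hx⟩ y).2.2

theorem isSolvable_of_isLeibniz_of_isCL [CharZero F] [FiniteDimensional F L]
    (h : IsLeibniz L) (hCL : IsCL F L) : IsSolvable F L := by
  by_contra hns
  have hr : ¬ LieAlgebra.IsSolvable (rightMultiplications F h) := fun _ =>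
    hns (isSolvable_of_isSolvable_rightMultiplications h)
  obtain ⟨s, hs⟩ := exists_isSimple_subalgebra F hr
  let Z : LieSubmodule F s L :=
    { LinearMap.ker (negMulRight F (L := L)) with
      lie_mem := by
        rintro ⟨⟨_, ⟨y, rfl⟩⟩, ha⟩ z hz
        have hz : negMulRight F z = 0 := hz
        change negMulRight F (-(z * y)) = 0
        rw [map_neg, negMulRight_mul h, hz, zero_lie, neg_zero] }
  obtain ⟨p, hpZ, hpid, hp⟩ := LieModule.exists_equivariant_projection Z
  have hsq : ∀ a : s, (a : Module.End F L) ^ 2 = 0 := by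
    intro a
    obtain ⟨⟨_, ⟨x, rfl⟩⟩, ha⟩ := a
    set a : s := ⟨⟨negMulRight F x, ⟨x, rfl⟩⟩, ha⟩
    -- x - p x lies in ker p and induces the same right multiplication as x.
    have hρ : negMulRight F (x - p x) = negMulRight F x := by
      rw [map_sub, show negMulRight F (p x) = 0 from hpZ x, sub_zero]
    have hp0 : p (x - p x) = 0 := by rw [map_sub, hpid _ (hpZ x), sub_self]
    have hax (y : L) : ⁅a, y⁆ = -(y * (x - p x)) := by
      rw [← negMulRight_apply (F := F), hρ]; rfl
    have hsqZ : (x - p x) * (x - p x) ∈ Z := by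
      change negMulRight F _ = 0
      rw [negMulRight_mul h, lie_self]
    -- The square lies in Z, so p fixes it; it is also -⁅a, x - p x⁆, so p kills it.
    have hzero : (x - p x) * (x - p x) = 0 := by
      have h1 := hp a (x - p x)
      rw [hp0, lie_zero, hax, map_neg, hpid _ hsqZ, neg_eq_zero] at h1
      exact h1
    ext y
    change ⁅a, ⁅a, y⁆⁆ = 0
    rw [hax, hax, neg_mul, neg_neg, hCL.mul_mul_self_eq_zero hzero]
  -- Engel's theorem: operators of square zero are ad-nilpotent.
  have hnil : LieRing.IsNilpotent s := by
    rw [LieAlgebra.isNilpotent_iff_forall (R := F)]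
    intro a
    have h1 : _root_.IsNilpotent (ad F (rightMultiplications F h) a) :=
      LieAlgebra.isNilpotent_ad_of_isNilpotent ⟨2, hsq a⟩
    exact LieSubalgebra.isNilpotent_ad_of_isNilpotent_ad s h1
  exact IsSimple.not_isSolvable F (s := s) inferInstance

end NonassocAlg

theorem mainTheorem1 {F L : Type*} [Field F] [CharZero F]
    [NonUnitalNonAssocRing L] [Module F L] [IsScalarTower F L L] [SMulCommClass F L L]
    [FiniteDimensional F L]
    (hLeibniz : NonassocAlg.IsLeibniz L) (hCL : NonassocAlg.IsCL F L) :
    NonassocAlg.IsSolvable F L := by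
  exact NonassocAlg.isSolvable_of_isLeibniz_of_isCL hLeibniz hCL
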